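/- Let $\mathbf B_3=\langle\sigma_1,\sigma_2\mid\sigma_1\sigma_2\sigma_1=\sigma_2\sigma_1\sigma_2\rangle$ be the group of braids with three strings, and let $\Delta=\sigma_1\sigma_2\sigma_1$. A braid $X\in\mathbf B_3$ is called quasipositive if $X=X_1\cdots X_k$ for some $k\ge 0$ and some $X_1,\dots,X_k\in\mathbf B_3$, each of which is conjugate in $\mathbf B_3$ to $\sigma_1$. A positive word is a finite (possibly empty) word over the alphabet $\{\sigma_1,\sigma_2\}$. A braid $X\in\mathbf B_3$ is quasipositive if and only if, for every integer $p\ge 0$ and every positive word $W$ such that $X=W\Delta^{-p}$ in $\mathbf B_3$, one can delete some (possibly none, possibly all) letters of $W$ so that the remaining word is equal to $\Delta^p$ in $\mathbf B_3$. -/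

import Mathlib

/-- The defining relator `σ₁σ₂σ₁ (σ₂σ₁σ₂)⁻¹` of the braid group on three strings;
the index `0 : Fin 2` stands for `σ₁` and `1 : Fin 2` for `σ₂`. -/
def braid3Rels : Set (FreeGroup (Fin 2)) :=
  {(FreeGroup.of 0 * FreeGroup.of 1 * FreeGroup.of 0) *
    (FreeGroup.of 1 * FreeGroup.of 0 * FreeGroup.of 1)⁻¹}

/-- The braid group `B₃ = ⟨σ₁, σ₂ | σ₁σ₂σ₁ = σ₂σ₁σ₂⟩`. -/
abbrev Braid3 : Type := PresentedGroup braid3Rels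

namespace Braid3

/-- The standard generators: `gen 0 = σ₁` and `gen 1 = σ₂`. -/
def gen (i : Fin 2) : Braid3 := PresentedGroup.of i

/-- The Garside element `Δ = σ₁σ₂σ₁`. -/
def garside : Braid3 := gen 0 * gen 1 * gen 0

/-- `(X₁, …, X_k)` is a quasipositive factorization of `X`: the product is `X` and every factor
is conjugate to `σ₁` (the empty factorization of the trivial braid is allowed). -/
def IsQuasipositiveFactorization (L : List Braid3) (X : Braid3) : Prop :=
  L.prod = X ∧ ∀ Y ∈ L, IsConj (gen 0) Y

/-- A braid is quasipositive if it admits at least one quasipositive factorization. -/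
def IsQuasipositive (X : Braid3) : Prop :=
  ∃ L : List Braid3, IsQuasipositiveFactorization L X

/-- A positive word: a word over the alphabet `{σ₁, σ₂}`. -/
abbrev PosWord : Type := List (Fin 2)

/-- The braid represented by a positive word. -/
def PosWord.toBraid (W : PosWord) : Braid3 := (W.map gen).prod

end Braid3

/-! ### The generators Δ and δ. -/

namespace Braid3

/-! The crux is that `Contains W p` (some subword of W represents Δ^p) depends only on p and the
braid of W, and is unchanged when Δ is appended and p raised by one. A product of conjugates g σ₁
g⁻¹, times a central Δ^(2n), has an explicit word with a subword for Δ^(2n); invariance carries this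
to every W. Conversely, deleting letters from W to get V exhibits W V⁻¹ as a product of conjugates
of generators.

The engine is `dualExponent`, the last exponent of δ modulo 3 in ⟨δ, Δ | δ³ = Δ²⟩. Since σ₁ = δ⁻¹Δ
and σ₂ = Δδ⁻¹, prepending a letter to a suffix keeps it or lowers it by one, the latter only if the
suffix is Δ⁻¹δⁿ or δⁿ. As δ³ is central, deleting such a letter divides the braid on the right by an
atom determined by n modulo 3. Hence a word for Δ^p σ₂ or Δ^p `thirdAtom` contains Δ^p, which yields
invariance under the braid relation and cancellation of Δ. Localizing the syntactic monoid at Δ²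
extends invariance to all equalities in the group. -/

theorem braid_relation : gen 0 * gen 1 * gen 0 = gen 1 * gen 0 * gen 1 := by
  have h : PresentedGroup.mk braid3Rels _ = 1 :=
    PresentedGroup.one_of_mem (rels := braid3Rels) (Set.mem_singleton _)
  simp only [map_mul, map_inv] at h
  exact mul_inv_eq_one.mp h

/-- The dual Garside element `δ = σ₁σ₂`. -/
def dual : Braid3 := gen 0 * gen 1

theorem garside_eq_mul : garside = gen 1 * gen 0 * gen 1 := braid_relation

theorem garside_eq_dual_mul : garside = dual * gen 0 := rfl

theorem garside_eq_mul_dual : garside = gen 1 * dual := by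
  rw [garside, braid_relation, dual, mul_assoc]

theorem garside_mul_gen_zero : garside * gen 0 = gen 1 * garside := by
  rw [garside_eq_mul_dual, mul_assoc, ← garside_eq_dual_mul, garside_eq_mul_dual]

theorem garside_mul_gen_one : garside * gen 1 = gen 0 * garside := by
  nth_rw 2 [garside_eq_mul]
  simp only [garside, mul_assoc]

theorem garside_sq : garside ^ 2 = dual ^ 3 := by
  rw [pow_succ, pow_one]
  nth_rw 1 [garside_eq_dual_mul]
  rw [garside_eq_mul_dual, pow_succ, pow_two]
  simp only [dual, mul_assoc]

theorem gen_induction {P : Braid3 → Prop} (one : P 1) (mul : ∀ i g, P g → P (gen i * g))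
    (inv_mul : ∀ i g, P g → P ((gen i)⁻¹ * g)) (g : Braid3) : P g := by
  have hg : g ∈ Subgroup.closure (Set.range (PresentedGroup.of : Fin 2 → Braid3)) := by
    rw [PresentedGroup.closure_range_of]; trivial
  rw [← Subgroup.mem_toSubmonoid, Subgroup.closure_toSubmonoid] at hg
  induction hg using Submonoid.closure_induction_left with
  | one => exact one
  | mul_left x hx y _ ih =>
    rcases hx with ⟨i, rfl⟩ | ⟨i, hi⟩
    · exact mul i y ih
    · have : x = (gen i)⁻¹ := by rw [gen, hi, inv_inv]
      rw [this]; exact inv_mul i y ih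

/-! ### The last exponent of δ modulo 3. -/

section Leading

open Classical in
/-- The indicator function of the subgroup generated by `δ`, with values in `ZMod 3`. -/
noncomputable def dualIndicator (g : Braid3) : ZMod 3 :=
  if g ∈ Subgroup.zpowers dual then 1 else 0

theorem dualIndicator_mul {h : Braid3} (hh : h ∈ Subgroup.zpowers dual) (g : Braid3) :
    dualIndicator (h * g) = dualIndicator g := by
  simp only [dualIndicator, Subgroup.mul_mem_cancel_left _ hh]

theorem dualIndicator_dual_mul (g : Braid3) : dualIndicator (dual * g) = dualIndicator g :=
  dualIndicator_mul (Subgroup.mem_zpowers _) g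

/-- Left multiplication on `Braid3`, coupled with a shift of the second coordinate. -/
def shiftPerm (x : Braid3) (s : Braid3 → ZMod 3) : Equiv.Perm (Braid3 × ZMod 3) where
  toFun y := (x * y.1, y.2 - s y.1)
  invFun y := (x⁻¹ * y.1, y.2 + s (x⁻¹ * y.1))
  left_inv y := by simp
  right_inv y := by simp

/-- The permutations by which the two generators act on `Braid3 × ZMod 3`. -/
noncomputable def genPerm (i : Fin 2) : Equiv.Perm (Braid3 × ZMod 3) :=
  if i = 0 then shiftPerm (gen 0) fun g => dualIndicator (garside * g)
  else shiftPerm (gen 1) dualIndicator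

theorem genPerm_zero (y : Braid3 × ZMod 3) :
    genPerm 0 y = (gen 0 * y.1, y.2 - dualIndicator (garside * y.1)) := rfl

theorem genPerm_one (y : Braid3 × ZMod 3) :
    genPerm 1 y = (gen 1 * y.1, y.2 - dualIndicator y.1) := rfl

theorem dualIndicator_gen_zero_mul (g : Braid3) :
    dualIndicator (gen 0 * g) = dualIndicator (garside * g) := by
  rw [garside_eq_dual_mul, mul_assoc, dualIndicator_dual_mul]

theorem dualIndicator_garside_mul_gen_one_mul (g : Braid3) :
    dualIndicator (garside * (gen 1 * g)) = dualIndicator g := by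
  rw [show garside * (gen 1 * g) = dual * (dual * g) by simp only [garside, dual, mul_assoc],
    dualIndicator_dual_mul, dualIndicator_dual_mul]

theorem three_indicator (k x : ZMod 3) : k - x - x - x = k := by
  revert k x; decide

/-- All three letters shift by the same indicator, and 3x = 0 in `ZMod 3`; hence the choice of
modulus. -/
theorem genPerm_braid_left (g : Braid3) (k : ZMod 3) :
    genPerm 0 (genPerm 1 (genPerm 0 (g, k))) = (garside * g, k) := by
  simp only [genPerm_zero, genPerm_one, Prod.mk.injEq]
  refine ⟨by simp only [garside, mul_assoc], ?_⟩
  rw [dualIndicator_garside_mul_gen_one_mul, dualIndicator_gen_zero_mul, three_indicator]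

theorem genPerm_braid_right (g : Braid3) (k : ZMod 3) :
    genPerm 1 (genPerm 0 (genPerm 1 (g, k))) = (garside * g, k) := by
  simp only [genPerm_zero, genPerm_one, Prod.mk.injEq]
  refine ⟨by simp only [garside_eq_mul, mul_assoc], ?_⟩
  rw [dualIndicator_garside_mul_gen_one_mul, ← mul_assoc, ← dual, dualIndicator_dual_mul,
    three_indicator]

/-- The action of `Braid3` on `Braid3 × ZMod 3` extending `genPerm`. -/
noncomputable def permRep : Braid3 →* Equiv.Perm (Braid3 × ZMod 3) :=
  PresentedGroup.toGroup (f := genPerm) (by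
    rintro r rfl
    rw [map_mul, map_inv, mul_inv_eq_one]
    ext1 ⟨g, k⟩
    simp only [map_mul, FreeGroup.lift_apply_of, Equiv.Perm.mul_apply]
    rw [genPerm_braid_left, genPerm_braid_right])

theorem permRep_gen (i : Fin 2) : permRep (gen i) = genPerm i :=
  PresentedGroup.toGroup.of _

theorem genPerm_fst (i : Fin 2) (y : Braid3 × ZMod 3) : (genPerm i y).1 = gen i * y.1 := by
  fin_cases i <;> rfl

theorem permRep_fst (g : Braid3) (y : Braid3 × ZMod 3) : (permRep g y).1 = g * y.1 := by
  induction g using gen_induction with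
  | one => simp
  | mul i g ih =>
    rw [map_mul, Equiv.Perm.mul_apply, permRep_gen, genPerm_fst, ih, mul_assoc]
  | inv_mul i g ih =>
    have h := genPerm_fst i (permRep ((gen i)⁻¹ * g) y)
    rw [← permRep_gen, ← Equiv.Perm.mul_apply, ← map_mul, mul_inv_cancel_left, ih] at h
    rw [mul_assoc, h, inv_mul_cancel_left]

/-- The exponent modulo `3` of the last power of `δ` in the normal form of a braid with respect
to `B₃ = ⟨δ, Δ | δ³ = Δ²⟩`. -/
noncomputable def dualExponent (g : Braid3) : ZMod 3 := (permRep g (1, 0)).2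

theorem permRep_base (g : Braid3) : permRep g (1, 0) = (g, dualExponent g) :=
  Prod.ext (by rw [permRep_fst, mul_one]) rfl

theorem dualExponent_one : dualExponent 1 = 0 := by simp [dualExponent]

theorem dualExponent_gen_zero_mul (g : Braid3) :
    dualExponent (gen 0 * g) = dualExponent g - dualIndicator (garside * g) := by
  rw [dualExponent, map_mul, Equiv.Perm.mul_apply, permRep_base, permRep_gen, genPerm_zero]

theorem dualExponent_gen_one_mul (g : Braid3) :
    dualExponent (gen 1 * g) = dualExponent g - dualIndicator g := by
  rw [dualExponent, map_mul, Equiv.Perm.mul_apply, permRep_base, permRep_gen, genPerm_one]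

theorem dualExponent_garside_mul (g : Braid3) :
    dualExponent (garside * g) = dualExponent g := by
  rw [dualExponent, garside]
  simp only [map_mul, Equiv.Perm.mul_apply, permRep_gen, permRep_base]
  rw [genPerm_braid_left]

theorem dualExponent_garside_pow_mul (n : ℕ) (g : Braid3) :
    dualExponent (garside ^ n * g) = dualExponent g := by
  induction n with
  | zero => rw [pow_zero, one_mul]
  | succ n ih => rw [pow_succ', mul_assoc, dualExponent_garside_mul, ih]

theorem dualExponent_dual_mul (g : Braid3) :
    dualExponent (dual * g) = dualExponent g + dualIndicator g := by
  rw [dual, mul_assoc, dualExponent_gen_zero_mul, dualExponent_gen_one_mul,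
    dualIndicator_garside_mul_gen_one_mul]
  generalize dualExponent g = k
  generalize dualIndicator g = x
  revert k x; decide

theorem dualIndicator_zpow (n : ℤ) : dualIndicator (dual ^ n) = 1 :=
  if_pos (Subgroup.zpow_mem_zpowers _ _)

theorem dualExponent_zpow (n : ℤ) : dualExponent (dual ^ n) = n := by
  have step (n : ℤ) : dualExponent (dual ^ (n + 1)) = dualExponent (dual ^ n) + 1 := by
    rw [add_comm, zpow_add, zpow_one, dualExponent_dual_mul, dualIndicator_zpow]
  induction n using Int.induction_on with
  | zero => simpa using dualExponent_one
  | succ n ih => rw [step, ih]; push_cast; rfl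
  | pred n ih =>
    have h := step (-n - 1)
    rw [sub_add_cancel, ih] at h
    rw [← sub_eq_iff_eq_add] at h
    rw [← h]; push_cast; rfl

end Leading

/-! ### Degree, centre and the third atom. -/

/-- The degree homomorphism, sending both generators to `1`. -/
def degree : Braid3 →* Multiplicative ℤ :=
  PresentedGroup.toGroup (f := fun _ => Multiplicative.ofAdd 1) (by rintro r rfl; simp)

theorem degree_gen (i : Fin 2) : degree (gen i) = Multiplicative.ofAdd 1 :=
  PresentedGroup.toGroup.of _

/-- Powers of δ have even degree, while this element has degree -1. -/
theorem gen_one_mul_dual_inv_notMem : gen 1 * dual⁻¹ ∉ Subgroup.zpowers dual := by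
  rintro ⟨n, hn⟩
  have h := congrArg (fun g => (degree g).toAdd) hn
  simp [dual, degree_gen] at h
  omega

/-- The third atom `σ₁σ₂σ₁⁻¹ = δσ₂δ⁻¹` of the dual Garside structure. -/
def thirdAtom : Braid3 := dual * (gen 1 * dual⁻¹)

theorem thirdAtom_mul_gen_zero : thirdAtom * gen 0 = dual := by
  simp [thirdAtom, dual, mul_assoc]

theorem dualExponent_thirdAtom : dualExponent thirdAtom = 1 := by
  have h : dualExponent (gen 1 * dual⁻¹) = 1 := by
    rw [dualExponent_gen_one_mul, ← zpow_neg_one, dualExponent_zpow, dualIndicator_zpow]; decide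
  rw [thirdAtom, dualExponent_dual_mul, h, dualIndicator, if_neg gen_one_mul_dual_inv_notMem,
    add_zero]

theorem garside_mul_gen (i : Fin 2) : garside * gen i = gen (1 - i) * garside := by
  fin_cases i
  · exact garside_mul_gen_zero
  · exact garside_mul_gen_one

theorem commute_garside_sq (g : Braid3) : Commute (garside ^ 2) g := by
  have h (i : Fin 2) : Commute (garside ^ 2) (gen i) := by
    rw [Commute, SemiconjBy, pow_two, mul_assoc, garside_mul_gen, ← mul_assoc, garside_mul_gen,
      sub_sub_cancel, mul_assoc]
  induction g using gen_induction with
  | one => exact Commute.one_right _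
  | mul i g ih => exact (h i).mul_right ih
  | inv_mul i g ih => exact (h i).inv_right.mul_right ih

theorem commute_dual_zpow {n : ℤ} (hn : (3 : ℤ) ∣ n) (g : Braid3) : Commute (dual ^ n) g := by
  obtain ⟨m, rfl⟩ := hn
  rw [zpow_mul, show (3 : ℤ) = (3 : ℕ) from rfl, zpow_natCast, ← garside_sq]
  exact (commute_garside_sq g).zpow_left m

theorem gen_one_mul_dual_zpow {n : ℤ} (hn : (3 : ℤ) ∣ n + 1) :
    gen 1 * dual ^ n = dual ^ n * thirdAtom := by
  have h := (commute_dual_zpow hn (gen 1)).eq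
  rw [thirdAtom, ← mul_assoc, ← zpow_add_one, ← mul_assoc, h, zpow_add_one, mul_assoc,
    mul_inv_cancel_right]

/-! ### Deleting one letter. -/

namespace PosWord

theorem toBraid_nil : toBraid [] = 1 := rfl

theorem toBraid_cons (i : Fin 2) (W : PosWord) : toBraid (i :: W) = gen i * toBraid W := by
  simp [toBraid]

theorem toBraid_append (V W : PosWord) : toBraid (V ++ W) = toBraid V * toBraid W := by
  simp [toBraid]

/-- One letter of `W` can be deleted, and the deletion divides the braid by `x` on the right. -/
def HasLetter (W : PosWord) (x : Braid3) : Prop :=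
  ∃ (A : PosWord) (i : Fin 2) (S : PosWord),
    W = A ++ i :: S ∧ gen i * toBraid S = toBraid S * x

theorem HasLetter.cons {W : PosWord} {x : Braid3} (h : HasLetter W x) (j : Fin 2) :
    HasLetter (j :: W) x := by
  obtain ⟨A, i, S, rfl, hx⟩ := h
  exact ⟨j :: A, i, S, rfl, hx⟩

theorem HasLetter.exists_sublist {W : PosWord} {x : Braid3} (h : HasLetter W x) :
    ∃ V : PosWord, V.Sublist W ∧ toBraid V * x = toBraid W := by
  obtain ⟨A, i, S, rfl, hx⟩ := h
  refine ⟨A ++ S, (List.Sublist.refl A).append (List.sublist_cons_self i S), ?_⟩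
  rw [toBraid_append, toBraid_append, toBraid_cons, hx, mul_assoc]

/-- The conjugator c is Δ⁻¹ for σ₁ and 1 for σ₂, so both letters reduce to σ₂ acting on δⁿ. -/
theorem exists_dual_zpow (i : Fin 2) (g : Braid3)
    (h : dualExponent (gen i * g) ≠ dualExponent g) :
    ∃ (c : Braid3) (n : ℤ), g = c * dual ^ n ∧ gen i * c = c * gen 1 ∧ dualExponent g = n ∧
      dualExponent (gen i * g) = n - 1 := by
  fin_cases i
  · simp only [Fin.zero_eta, dualExponent_gen_zero_mul] at h ⊢
    have hm : garside * g ∈ Subgroup.zpowers dual := by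
      by_contra hm
      simp [dualIndicator, hm] at h
    obtain ⟨n, hn⟩ := hm
    have hg : dualExponent g = n := by
      rw [← dualExponent_garside_mul, ← hn]; exact dualExponent_zpow n
    refine ⟨garside⁻¹, n, ?_, ?_, hg, ?_⟩
    · rw [show dual ^ n = garside * g from hn, inv_mul_cancel_left]
    · rw [mul_inv_eq_iff_eq_mul, mul_assoc, ← garside_mul_gen_zero, inv_mul_cancel_left]
    · rw [hg, ← show dual ^ n = garside * g from hn, dualIndicator_zpow]
  · simp only [Fin.mk_one, dualExponent_gen_one_mul] at h ⊢
    have hm : g ∈ Subgroup.zpowers dual := by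
      by_contra hm
      simp [dualIndicator, hm] at h
    obtain ⟨n, rfl⟩ := hm
    exact ⟨1, n, by simp, by simp, dualExponent_zpow n,
      by simp [dualExponent_zpow, dualIndicator_zpow]⟩

theorem hasLetter_of_dualExponent (W : PosWord) :
    (dualExponent (toBraid W) ≠ 0 → HasLetter W (gen 1)) ∧
      (dualExponent (toBraid W) = 1 → HasLetter W thirdAtom) := by
  induction W with
  | nil => simp [toBraid_nil, dualExponent_one]
  | cons i S ih =>
    rw [toBraid_cons]
    by_cases h : dualExponent (gen i * toBraid S) = dualExponent (toBraid S)
    · rw [h]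
      exact ⟨fun hS => (ih.1 hS).cons i, fun hS => (ih.2 hS).cons i⟩
    obtain ⟨c, n, hS, hc, hn, hi⟩ := exists_dual_zpow i _ h
    rw [hi]
    constructor
    · intro h1
      -- The exponent starts at 0 on the empty word, so it must leave 0 either at this letter or
      -- inside S.
      by_cases h0 : (n : ZMod 3) = 0
      · refine ⟨[], i, S, rfl, ?_⟩
        have h3 := (commute_dual_zpow ((ZMod.intCast_zmod_eq_zero_iff_dvd n 3).mp h0) (gen 1)).eq
        rw [hS, ← mul_assoc, hc, mul_assoc, mul_assoc, h3]
      · exact (ih.1 (by rwa [hn])).cons i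
    · intro h1
      refine ⟨[], i, S, rfl, ?_⟩
      -- The value 1 is entered only from 2 = -1, which makes δ^(n+1) central.
      have h0 : ((n + 1 : ℤ) : ZMod 3) = 0 := by
        push_cast
        rw [sub_eq_iff_eq_add.mp h1]; decide
      have h3 := gen_one_mul_dual_zpow ((ZMod.intCast_zmod_eq_zero_iff_dvd (n + 1) 3).mp h0)
      rw [hS, ← mul_assoc, hc, mul_assoc, mul_assoc, h3]

/-! ### Subwords representing powers of Δ. -/

/-- The words from which a word for `Δ ^ p` can be obtained by deleting letters. -/
def Contains (W : PosWord) (p : ℕ) : Prop :=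
  ∃ V : PosWord, V.Sublist W ∧ toBraid V = garside ^ p

theorem Contains.mono {V W : PosWord} {p : ℕ} (h : Contains V p) (hVW : V.Sublist W) :
    Contains W p := by
  obtain ⟨U, hU, hp⟩ := h
  exact ⟨U, hU.trans hVW, hp⟩

theorem Contains.append {V W : PosWord} {p q : ℕ} (hV : Contains V p) (hW : Contains W q) :
    Contains (V ++ W) (p + q) := by
  obtain ⟨A, hA, hp⟩ := hV
  obtain ⟨B, hB, hq⟩ := hW
  exact ⟨A ++ B, hA.append hB, by rw [toBraid_append, hp, hq, pow_add]⟩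

/-- The word obtained by exchanging the two letters. -/
def flip (W : PosWord) : PosWord := W.map fun i => 1 - i

theorem flip_flip (W : PosWord) : flip (flip W) = W := by
  simp [flip]

theorem garside_mul_toBraid (W : PosWord) :
    garside * toBraid W = toBraid (flip W) * garside := by
  induction W with
  | nil => simp [flip, toBraid_nil]
  | cons i W ih =>
    have : flip (i :: W) = (1 - i) :: flip W := rfl
    rw [this, toBraid_cons, toBraid_cons, ← mul_assoc, garside_mul_gen, mul_assoc, ih, mul_assoc]

theorem Contains.flip {W : PosWord} {p : ℕ} (h : Contains W p) : Contains (flip W) p := by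
  obtain ⟨V, hV, hp⟩ := h
  refine ⟨V.flip, hV.map _, ?_⟩
  rw [← mul_left_inj garside, ← garside_mul_toBraid, hp, ← pow_succ, ← pow_succ']

theorem contains_of_gen_one {W : PosWord} {p : ℕ} (h : toBraid W = garside ^ p * gen 1) :
    Contains W p := by
  have hf : dualExponent (toBraid W) ≠ 0 := by
    rw [h, dualExponent_garside_pow_mul, ← mul_one (gen 1), dualExponent_gen_one_mul,
      dualExponent_one, ← zpow_zero dual, dualIndicator_zpow]
    decide
  obtain ⟨V, hV, hVW⟩ := ((hasLetter_of_dualExponent W).1 hf).exists_sublist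
  exact ⟨V, hV, mul_right_cancel (hVW.trans h)⟩

theorem contains_of_thirdAtom {W : PosWord} {p : ℕ} (h : toBraid W = garside ^ p * thirdAtom) :
    Contains W p := by
  have hf : dualExponent (toBraid W) = 1 := by
    rw [h, dualExponent_garside_pow_mul, dualExponent_thirdAtom]
  obtain ⟨V, hV, hVW⟩ := ((hasLetter_of_dualExponent W).2 hf).exists_sublist
  exact ⟨V, hV, mul_right_cancel (hVW.trans h)⟩

theorem toBraid_flip_of_eq {W : PosWord} {p : ℕ} {U : PosWord}
    (h : toBraid W = garside ^ p * toBraid U) :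
    toBraid (flip W) = garside ^ p * toBraid (flip U) := by
  rw [← mul_left_inj garside, ← garside_mul_toBraid, h, mul_assoc, ← garside_mul_toBraid,
    ← mul_assoc, ← mul_assoc, ← pow_succ, ← pow_succ']

theorem contains_of_flip {W : PosWord} {p : ℕ} (h : Contains (flip W) p) : Contains W p := by
  simpa [flip_flip] using h.flip

theorem contains_of_gen_zero {W : PosWord} {p : ℕ} (h : toBraid W = garside ^ p * gen 0) :
    Contains W p := by
  apply contains_of_flip
  apply contains_of_gen_one
  have := toBraid_flip_of_eq (U := [0]) (by simpa [toBraid] using h)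
  simpa [toBraid, flip] using this

theorem contains_of_dual {W : PosWord} {p : ℕ} (h : toBraid W = garside ^ p * (gen 0 * gen 1)) :
    Contains W p := by
  have hf : dualExponent (toBraid W) ≠ 0 := by
    rw [h, dualExponent_garside_pow_mul, ← dual, ← zpow_one dual, dualExponent_zpow]
    decide
  obtain ⟨V, hV, hVW⟩ := ((hasLetter_of_dualExponent W).1 hf).exists_sublist
  rw [h, ← mul_assoc] at hVW
  exact (contains_of_gen_zero (mul_right_cancel hVW)).mono hV

theorem contains_of_dual_flip {W : PosWord} {p : ℕ}
    (h : toBraid W = garside ^ p * (gen 1 * gen 0)) : Contains W p := by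
  apply contains_of_flip
  apply contains_of_dual
  have := toBraid_flip_of_eq (U := [1, 0]) (by simpa [toBraid] using h)
  simpa [toBraid, flip] using this

theorem eq_thirdAtom_of_mul_sq {g : Braid3} {p : ℕ}
    (h : g * (gen 0 * gen 0) = garside ^ (p + 1)) : g = garside ^ p * thirdAtom := by
  rw [← mul_left_inj (gen 0), mul_assoc (garside ^ p), thirdAtom_mul_gen_zero,
    ← mul_left_inj (gen 0), mul_assoc, h, mul_assoc, ← garside_eq_dual_mul, pow_succ]

theorem sublist_aba {v : PosWord} (h : v.Sublist [0, 1, 0]) :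
    v = [] ∨ v = [0] ∨ v = [1] ∨ v = [0, 1] ∨ v = [1, 0] ∨ v = [0, 0] ∨ v = [0, 1, 0] := by
  rw [← List.mem_sublists] at h
  revert v
  decide

theorem toBraid_aba : toBraid [0, 1, 0] = garside := by
  simp [toBraid, garside, mul_assoc]

theorem toBraid_bab : toBraid [1, 0, 1] = garside := by
  simp [toBraid, garside_eq_mul, mul_assoc]

theorem flip_iterate_sublist {V W : PosWord} {n : ℕ} (h : V.Sublist (flip^[n] W)) :
    ∃ U : PosWord, U.Sublist W ∧ V = flip^[n] U := by
  induction n generalizing V with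
  | zero => exact ⟨V, h, rfl⟩
  | succ n ih =>
    rw [Function.iterate_succ_apply'] at h
    have h' := h.map fun i => 1 - i
    obtain ⟨U, hU, hV⟩ := ih (V := flip V) (by rwa [← flip, ← flip, flip_flip] at h')
    exact ⟨U, hU, by rw [Function.iterate_succ_apply', ← hV, flip_flip]⟩

theorem garside_pow_mul_toBraid (n : ℕ) (W : PosWord) :
    garside ^ n * toBraid W = toBraid (flip^[n] W) * garside ^ n := by
  induction n generalizing W with
  | zero => simp
  | succ n ih =>
    rw [pow_succ, mul_assoc, garside_mul_toBraid, ← mul_assoc, ih, mul_assoc,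
      Function.iterate_succ_apply]

theorem degree_toBraid (W : PosWord) : (degree (toBraid W)).toAdd = W.length := by
  induction W with
  | nil => simp [toBraid_nil]
  | cons i W ih => rw [toBraid_cons, map_mul, degree_gen]; simp [ih, add_comm]

/-! ### Invariance under the braid relation and cancellation of Δ. -/

theorem contains_of_sq {A B : PosWord} {p : ℕ}
    (h : toBraid (A ++ ([0, 0] ++ B)) = garside ^ p) : Contains (A ++ ([1, 0, 1] ++ B)) p := by
  obtain _ | p := p
  · have := congrArg (fun g => (degree g).toAdd) h
    simp only [degree_toBraid] at this
    simp at this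
    omega
  have hsq : toBraid [0, 0] = gen 0 * gen 0 := by simp [toBraid]
  rw [toBraid_append, toBraid_append, hsq] at h
  -- B is carried round to the front through Δ^(p+1), which flips it p+1 times.
  have hC : toBraid (flip^[p + 1] B ++ A) * (gen 0 * gen 0) = garside ^ (p + 1) := by
    rw [← mul_left_inj (toBraid B), garside_pow_mul_toBraid, ← h, toBraid_append]
    simp only [mul_assoc]
  obtain ⟨V, hV, hp⟩ := contains_of_thirdAtom (eq_thirdAtom_of_mul_sq hC)
  obtain ⟨V₁, V₂, rfl, h₁, h₂⟩ := List.sublist_append_iff.mp hV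
  obtain ⟨U, hU, rfl⟩ := flip_iterate_sublist h₁
  -- With U carried back to the end, σ₂σ₁σ₂ = Δ supplies the missing factor.
  refine ⟨V₂ ++ ([1, 0, 1] ++ U), h₂.append ((List.Sublist.refl _).append hU), ?_⟩
  rw [toBraid_append, toBraid_append, toBraid_bab, ← mul_right_inj (toBraid (flip^[p + 1] U)),
    ← garside_pow_mul_toBraid, ← mul_assoc, ← toBraid_append, hp, ← mul_assoc, ← pow_succ]

/-- Among the subwords of σ₁σ₂σ₁ only σ₁² has no equal counterpart in σ₂σ₁σ₂; `contains_of_sq`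
handles it. -/
theorem Contains.replace_aba {A B : PosWord} {p : ℕ} (h : Contains (A ++ ([0, 1, 0] ++ B)) p) :
    Contains (A ++ ([1, 0, 1] ++ B)) p := by
  obtain ⟨V, hV, hp⟩ := h
  obtain ⟨A', V', rfl, hA, hV'⟩ := List.sublist_append_iff.mp hV
  obtain ⟨v, B', rfl, hv, hB⟩ := List.sublist_append_iff.mp hV'
  have key {v' : PosWord} (hs : v'.Sublist [1, 0, 1]) (he : toBraid v' = toBraid v) :
      Contains (A ++ ([1, 0, 1] ++ B)) p := by
    refine ⟨A' ++ (v' ++ B'), hA.append (hs.append hB), ?_⟩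
    rw [← hp]
    simp only [toBraid_append, he]
  rcases sublist_aba hv with rfl | rfl | rfl | rfl | rfl | rfl | rfl
  · exact key (by decide) rfl
  · exact key (by decide) rfl
  · exact key (by decide) rfl
  · exact key (by decide) rfl
  · exact key (by decide) rfl
  · exact (contains_of_sq hp).mono (hA.append ((List.Sublist.refl _).append hB))
  · exact key (List.Sublist.refl _) (toBraid_bab.trans toBraid_aba.symm)

theorem contains_braid_iff {A B : PosWord} {p : ℕ} :
    Contains (A ++ ([0, 1, 0] ++ B)) p ↔ Contains (A ++ ([1, 0, 1] ++ B)) p := by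
  refine ⟨Contains.replace_aba, fun h => contains_of_flip ?_⟩
  have h' := h.flip
  simp only [flip, List.map_append] at h' ⊢
  exact Contains.replace_aba h'

theorem Contains.cancel_garside {W : PosWord} {p : ℕ} (h : Contains (W ++ [0, 1, 0]) (p + 1)) :
    Contains W p := by
  obtain ⟨V, hV, hp⟩ := h
  obtain ⟨V, v, rfl, hVW, hv⟩ := List.sublist_append_iff.mp hV
  refine Contains.mono ?_ hVW
  clear hV hVW W
  rw [toBraid_append] at hp
  have cancel_zero {g : Braid3} (h : g * gen 0 = garside ^ (p + 1)) :
      g = garside ^ p * (gen 0 * gen 1) := by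
    rw [← mul_left_inj (gen 0), h, pow_succ, mul_assoc (garside ^ p), ← garside]
  have cancel_one {g : Braid3} (h : g * gen 1 = garside ^ (p + 1)) :
      g = garside ^ p * (gen 1 * gen 0) := by
    rw [← mul_left_inj (gen 1), h, pow_succ, mul_assoc (garside ^ p), ← garside_eq_mul]
  rcases sublist_aba hv with rfl | rfl | rfl | rfl | rfl | rfl | rfl <;>
    simp only [toBraid_cons, toBraid_nil, mul_one] at hp
  -- If nothing of the final Δ is used, dropping the last letter of V reduces to the single-letter
  -- cases.
  · obtain rfl | ⟨U, i, rfl⟩ := List.eq_nil_or_concat V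
    · have := congrArg (fun g => (degree g).toAdd) hp
      simp [toBraid_nil, garside, degree_gen] at this
      omega
    rw [List.concat_eq_append, toBraid_append, toBraid_cons, toBraid_nil, mul_one] at hp
    rw [List.concat_eq_append]
    refine Contains.mono ?_ (List.sublist_append_left U [i])
    fin_cases i
    · exact contains_of_dual (cancel_zero hp)
    · exact contains_of_dual_flip (cancel_one hp)
  · exact contains_of_dual (cancel_zero hp)
  · exact contains_of_dual_flip (cancel_one hp)
  · refine contains_of_gen_one (mul_right_cancel (b := gen 0 * gen 1) ?_)
    rw [hp, mul_assoc, ← mul_assoc (gen 1), ← garside_eq_mul, pow_succ]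
  · refine contains_of_gen_zero (mul_right_cancel (b := gen 1 * gen 0) ?_)
    rw [hp, mul_assoc, ← mul_assoc (gen 0), ← garside, pow_succ]
  · exact contains_of_thirdAtom (eq_thirdAtom_of_mul_sq hp)
  · rw [← mul_assoc (gen 0), ← garside, pow_succ] at hp
    exact ⟨V, List.Sublist.refl V, mul_right_cancel hp⟩

/-! ### From words to braids by localization. -/

/-- The syntactic congruence of the family of languages `{W | Contains W p}`. -/
def containsCon : Con (FreeMonoid (Fin 2)) where
  r V W := ∀ (A B : PosWord) (p : ℕ),
    Contains (A ++ (V.toList ++ B)) p ↔ Contains (A ++ (W.toList ++ B)) p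
  iseqv := ⟨fun _ _ _ _ => Iff.rfl, fun h A B p => (h A B p).symm,
    fun h h' A B p => (h A B p).trans (h' A B p)⟩
  mul' {V V' W W'} h h' A B p := by
    have h₁ := h A (W.toList ++ B) p
    have h₂ := h' (A ++ V'.toList) B p
    simp only [List.append_assoc] at h₂
    simpa only [FreeMonoid.toList_mul, List.append_assoc] using h₁.trans h₂

/-- The quotient of the monoid of positive words by `containsCon`. -/
abbrev ContainsMonoid : Type := containsCon.Quotient

/-- The class of a positive word in `ContainsMonoid`. -/
def toQuotient (W : PosWord) : ContainsMonoid := containsCon.mk' (FreeMonoid.ofList W)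

theorem toQuotient_append (V W : PosWord) :
    toQuotient (V ++ W) = toQuotient V * toQuotient W := by
  rw [toQuotient, FreeMonoid.ofList_append, map_mul]; rfl

theorem toQuotient_cons (i : Fin 2) (W : PosWord) :
    toQuotient (i :: W) = toQuotient [i] * toQuotient W :=
  toQuotient_append [i] W

theorem toQuotient_nil : toQuotient [] = 1 := rfl

theorem contains_iff_of_toQuotient_eq {V W : PosWord} (h : toQuotient V = toQuotient W) (p : ℕ) :
    Contains V p ↔ Contains W p := by
  simpa using (Con.eq _).mp h [] [] p

theorem toQuotient_braid : toQuotient [0, 1, 0] = toQuotient [1, 0, 1] :=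
  (Con.eq _).mpr fun _ _ _ => contains_braid_iff

theorem toQuotient_garside_mul (i : Fin 2) :
    toQuotient [0, 1, 0] * toQuotient [i] = toQuotient [1 - i] * toQuotient [0, 1, 0] := by
  fin_cases i
  · calc
      _ = toQuotient [1, 0, 1] * toQuotient [0] := by rw [toQuotient_braid]; rfl
      _ = toQuotient [1] * toQuotient [0, 1, 0] := by simp only [← toQuotient_append]; rfl
  · calc
      _ = toQuotient [0] * toQuotient [1, 0, 1] := by simp only [← toQuotient_append]; rfl
      _ = toQuotient [0] * toQuotient [0, 1, 0] := by rw [toQuotient_braid]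

/-- The image in `ContainsMonoid` of the generator of the centre. -/
def centralElement : ContainsMonoid := toQuotient [0, 1, 0] * toQuotient [0, 1, 0]

theorem commute_centralElement (x : ContainsMonoid) : Commute centralElement x := by
  obtain ⟨W, rfl⟩ := containsCon.mk'_surjective x
  obtain ⟨W, rfl⟩ := FreeMonoid.ofList.surjective W
  change Commute centralElement (toQuotient W)
  induction W with
  | nil => exact Commute.one_right _
  | cons i W ih =>
    rw [toQuotient_cons]
    refine Commute.mul_right ?_ ih
    rw [Commute, SemiconjBy, centralElement, mul_assoc, toQuotient_garside_mul, ← mul_assoc,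
      toQuotient_garside_mul, sub_sub_cancel, mul_assoc]

instance : OreLocalization.OreSet (Submonoid.powers centralElement) where
  ore_right_cancel := by
    rintro r₁ r₂ ⟨s, n, rfl⟩ h
    exact ⟨⟨_, n, rfl⟩, by
      simpa only [((commute_centralElement _).pow_left n).eq] using h⟩
  oreNum r _ := r
  oreDenom _ s := s
  ore_eq := by
    rintro r ⟨s, n, rfl⟩
    exact ((commute_centralElement r).pow_left n).eq

/-- The localization of `ContainsMonoid` at the generator of the centre. -/
abbrev ContainsLocalization : Type :=
  OreLocalization (Submonoid.powers centralElement) ContainsMonoid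

/-- The class of a positive word in `ContainsLocalization`. -/
def toLocalization (W : PosWord) : ContainsLocalization :=
  OreLocalization.numeratorHom (toQuotient W)

theorem toLocalization_append (V W : PosWord) :
    toLocalization (V ++ W) = toLocalization V * toLocalization W := by
  rw [toLocalization, toQuotient_append, map_mul]; rfl

theorem toLocalization_braid : toLocalization [0, 1, 0] = toLocalization [1, 0, 1] := by
  rw [toLocalization, toQuotient_braid]; rfl

theorem isUnit_of_mul {M : Type*} [Monoid M] {x y z : M} (h : IsUnit (x * y))
    (h' : IsUnit (z * x)) : IsUnit x := by
  obtain ⟨u, hu⟩ := h.exists_right_inv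
  obtain ⟨v, hv⟩ := h'.exists_left_inv
  exact isUnit_iff_exists.mpr ⟨y * u, by rw [← mul_assoc, hu], by
    rw [← left_inv_eq_right_inv (a := x) (b := v * z) (c := y * u) (by rw [mul_assoc, hv])
      (by rw [← mul_assoc, hu]), mul_assoc, hv]⟩

theorem isUnit_toLocalization_garside : IsUnit (toLocalization [0, 1, 0]) := by
  have h : IsUnit (toLocalization [0, 1, 0] * toLocalization [0, 1, 0]) := by
    rw [toLocalization, ← map_mul]
    exact OreLocalization.numerator_isUnit ⟨centralElement, Submonoid.mem_powers _⟩
  exact isUnit_of_mul h h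

theorem isUnit_toLocalization (i : Fin 2) : IsUnit (toLocalization [i]) := by
  have h := isUnit_toLocalization_garside
  fin_cases i
  · exact isUnit_of_mul (y := toLocalization [1, 0]) (z := toLocalization [0, 1])
      (by rwa [← toLocalization_append]) (by rwa [← toLocalization_append])
  · rw [toLocalization_braid] at h
    exact isUnit_of_mul (y := toLocalization [0, 1]) (z := toLocalization [1, 0])
      (by rwa [← toLocalization_append]) (by rwa [← toLocalization_append])

/-- The homomorphism from the braid group to the units of `ContainsLocalization`. -/
noncomputable def unitsHom : Braid3 →* ContainsLocalizationˣ :=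
  PresentedGroup.toGroup (f := fun i => (isUnit_toLocalization i).unit) (by
    rintro r rfl
    rw [map_mul, map_inv, mul_inv_eq_one]
    ext1
    simp only [map_mul, FreeGroup.lift_apply_of, Units.val_mul, IsUnit.unit_spec]
    simp only [← toLocalization_append]
    exact toLocalization_braid)

theorem unitsHom_toBraid (W : PosWord) :
    (unitsHom (toBraid W) : ContainsLocalization) = toLocalization W := by
  induction W with
  | nil => rw [toBraid_nil, map_one, Units.val_one, toLocalization, toQuotient_nil, map_one]
  | cons i W ih =>
    rw [toBraid_cons, map_mul, Units.val_mul, ih, gen, unitsHom, PresentedGroup.toGroup.of,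
      IsUnit.unit_spec, ← toLocalization_append]
    rfl

/-- The positive word `(σ₁σ₂σ₁) ^ n`. -/
def garsideWord : ℕ → PosWord
  | 0 => []
  | n + 1 => garsideWord n ++ [0, 1, 0]

theorem toBraid_garsideWord (n : ℕ) : toBraid (garsideWord n) = garside ^ n := by
  induction n with
  | zero => rfl
  | succ n ih => rw [garsideWord, toBraid_append, ih, toBraid_aba, pow_succ]

theorem toQuotient_garsideWord (n : ℕ) :
    toQuotient (garsideWord (2 * n)) = centralElement ^ n := by
  induction n with
  | zero => rfl
  | succ n ih =>
    rw [mul_add, mul_one, garsideWord, garsideWord, toQuotient_append, toQuotient_append, ih,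
      mul_assoc, pow_succ, centralElement]

theorem contains_garsideWord (n : ℕ) : Contains (garsideWord n) n :=
  ⟨_, List.Sublist.refl _, toBraid_garsideWord n⟩

theorem contains_append_garsideWord_iff {W : PosWord} {p n : ℕ} :
    Contains (W ++ garsideWord n) (p + n) ↔ Contains W p := by
  refine ⟨fun h => ?_, fun h => h.append (contains_garsideWord n)⟩
  induction n with
  | zero => simpa [garsideWord] using h
  | succ n ih =>
    rw [garsideWord, ← List.append_assoc, ← add_assoc] at h
    exact ih h.cancel_garside

theorem contains_iff_of_toBraid_eq {V W : PosWord} (h : toBraid V = toBraid W) (p : ℕ) :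
    Contains V p ↔ Contains W p := by
  have hl : toLocalization V = toLocalization W := by
    rw [← unitsHom_toBraid, h, unitsHom_toBraid]
  -- Equality of fractions holds in the monoid after multiplying by a power of Δ², which is then
  -- cancelled.
  obtain ⟨⟨_, n, rfl⟩, v, h₁, h₂⟩ := OreLocalization.oreDiv_eq_iff.mp hl
  obtain rfl : centralElement ^ n = v := by simpa using h₂
  have hq : toQuotient (V ++ garsideWord (2 * n)) = toQuotient (W ++ garsideWord (2 * n)) := by
    rw [toQuotient_append, toQuotient_append, toQuotient_garsideWord,
      ← ((commute_centralElement _).pow_left n).eq, ← ((commute_centralElement _).pow_left n).eq]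
    exact h₁.symm
  rw [← contains_append_garsideWord_iff (n := 2 * n), contains_iff_of_toQuotient_eq hq,
    contains_append_garsideWord_iff]

theorem exists_toBraid_eq (g : Braid3) :
    ∃ (U : PosWord) (n : ℕ), toBraid U = g * (garside ^ 2) ^ n := by
  induction g using gen_induction with
  | one => exact ⟨[], 0, by simp [toBraid_nil]⟩
  | mul i g ih =>
    obtain ⟨U, n, h⟩ := ih
    exact ⟨i :: U, n, by rw [toBraid_cons, h, mul_assoc]⟩
  | inv_mul i g ih =>
    obtain ⟨U, n, h⟩ := ih
    have hi : ∃ V : PosWord, gen i * toBraid V = garside := by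
      fin_cases i
      · exact ⟨[1, 0], toBraid_aba⟩
      · exact ⟨[0, 1], toBraid_bab⟩
    obtain ⟨V, hV⟩ := hi
    refine ⟨V ++ ([0, 1, 0] ++ U), n + 1, ?_⟩
    rw [toBraid_append, toBraid_append, h, toBraid_aba, ← mul_right_inj (gen i), ← mul_assoc, hV,
      mul_assoc, mul_inv_cancel_left, ← mul_assoc, ← pow_two, ← mul_assoc,
      (commute_garside_sq g).eq, mul_assoc, ← pow_succ']

end PosWord

/-! ### Quasipositive braids and deletions. -/

open PosWord

theorem IsQuasipositive.one : IsQuasipositive 1 := ⟨[], rfl, by simp⟩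

theorem IsQuasipositive.mul {X Y : Braid3} (hX : IsQuasipositive X) (hY : IsQuasipositive Y) :
    IsQuasipositive (X * Y) := by
  obtain ⟨L, rfl, hL⟩ := hX
  obtain ⟨M, rfl, hM⟩ := hY
  exact ⟨L ++ M, List.prod_append, fun Z hZ => (List.mem_append.mp hZ).elim (hL Z) (hM Z)⟩

theorem isConj_gen (i : Fin 2) : IsConj (gen 0) (gen i) := by
  fin_cases i
  · exact IsConj.refl _
  · exact isConj_iff.mpr ⟨garside, by rw [garside_mul_gen_zero]; exact mul_inv_cancel_right _ _⟩

theorem IsQuasipositive.gen (i : Fin 2) : IsQuasipositive (gen i) :=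
  ⟨[Braid3.gen i], by simp, by simpa using isConj_gen i⟩

theorem IsQuasipositive.conj {X : Braid3} (hX : IsQuasipositive X) (g : Braid3) :
    IsQuasipositive (g * X * g⁻¹) := by
  obtain ⟨L, rfl, hL⟩ := hX
  refine ⟨L.map (MulAut.conj g), ?_, ?_⟩
  · rw [← map_list_prod, MulAut.conj_apply]
  · intro Y hY
    obtain ⟨Z, hZ, rfl⟩ := List.mem_map.mp hY
    exact (hL Z hZ).trans (isConj_iff.mpr ⟨g, rfl⟩)

/-- A kept letter conjugates the quotient W V⁻¹; a deleted letter multiplies it by a generator. -/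
theorem isQuasipositive_of_sublist {V W : PosWord} (h : V.Sublist W) :
    IsQuasipositive (toBraid W * (toBraid V)⁻¹) := by
  induction h with
  | slnil => simpa using IsQuasipositive.one
  | cons i _ ih =>
    rw [toBraid_cons, mul_assoc]
    exact (IsQuasipositive.gen i).mul ih
  | cons_cons i _ ih =>
    rw [toBraid_cons, toBraid_cons, mul_inv_rev]
    simpa only [mul_assoc] using ih.conj (Braid3.gen i)

theorem exists_contains_of_isConj {L : List Braid3} (h : ∀ Y ∈ L, IsConj (gen 0) Y) :
    ∃ (W : PosWord) (n : ℕ), toBraid W = L.prod * (garside ^ 2) ^ n ∧ Contains W (2 * n) := by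
  induction L with
  | nil => exact ⟨[], 0, by simp [toBraid_nil], contains_garsideWord 0⟩
  | cons Y L ih =>
    obtain ⟨W, n, hW, hc⟩ := ih fun Z hZ => h Z (List.mem_cons_of_mem _ hZ)
    obtain ⟨g, hg⟩ := isConj_iff.mp (h Y List.mem_cons_self)
    obtain ⟨U, k, hU⟩ := exists_toBraid_eq g
    obtain ⟨V, l, hV⟩ := exists_toBraid_eq g⁻¹
    have hcomm (m : ℕ) (x y : Braid3) :
        (garside ^ 2) ^ m * (x * y) = x * ((garside ^ 2) ^ m * y) := by
      rw [← mul_assoc, ((commute_garside_sq x).pow_left m).eq, mul_assoc]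
    -- U σ₁ V represents g σ₁ g⁻¹ Δ^(2(k+l)); deleting its σ₁ leaves Δ^(2(k+l)).
    refine ⟨U ++ (0 :: V) ++ W, k + l + n, ?_, ?_⟩
    · rw [toBraid_append, toBraid_append, toBraid_cons, hU, hV, hW, List.prod_cons, ← hg]
      simp only [mul_assoc, pow_add]
      rw [hcomm l L.prod, hcomm k (gen 0), hcomm k g⁻¹, hcomm k L.prod]
    · have hUV : Contains (U ++ V) (2 * (k + l)) := by
        refine ⟨_, List.Sublist.refl _, ?_⟩
        rw [toBraid_append, hU, hV, mul_assoc, hcomm, mul_inv_cancel_left, ← pow_add, ← pow_mul]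
      rw [mul_add]
      exact (hUV.mono ((List.Sublist.refl U).append (List.sublist_cons_self 0 V))).append hc

end Braid3

theorem corollary1 (X : Braid3) :
    Braid3.IsQuasipositive X ↔
      ∀ (p : ℕ) (W : Braid3.PosWord),
        X = Braid3.PosWord.toBraid W * Braid3.garside ^ (-(p : ℤ)) →
          ∃ V : Braid3.PosWord,
            List.Sublist V W ∧ Braid3.PosWord.toBraid V = Braid3.garside ^ p := by
  constructor
  · rintro ⟨L, rfl, hL⟩ p W hW
    obtain ⟨U, n, hU, hc⟩ := Braid3.exists_contains_of_isConj hL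
    rw [zpow_neg, zpow_natCast, eq_mul_inv_iff_mul_eq] at hW
    -- Padding W by Δ^(2n) and U by Δ^p makes both words represent X Δ^(p+2n).
    have h : Braid3.PosWord.toBraid (W ++ Braid3.PosWord.garsideWord (2 * n)) =
        Braid3.PosWord.toBraid (U ++ Braid3.PosWord.garsideWord p) := by
      rw [Braid3.PosWord.toBraid_append, Braid3.PosWord.toBraid_append, hU, ← hW,
        Braid3.PosWord.toBraid_garsideWord, Braid3.PosWord.toBraid_garsideWord, ← pow_mul,
        mul_assoc, mul_assoc, ← pow_add, ← pow_add, add_comm]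
    refine (Braid3.PosWord.contains_append_garsideWord_iff (n := 2 * n)).mp ?_
    rw [Braid3.PosWord.contains_iff_of_toBraid_eq h, add_comm,
      Braid3.PosWord.contains_append_garsideWord_iff]
    exact hc
  · intro h
    obtain ⟨W, n, hW⟩ := Braid3.PosWord.exists_toBraid_eq X
    rw [← pow_mul, ← mul_inv_eq_iff_eq_mul] at hW
    obtain ⟨V, hV, hp⟩ := h (2 * n) W (by rw [← hW, zpow_neg, zpow_natCast])
    rw [← hW, ← hp]
    exact Braid3.isQuasipositive_of_sublist hV
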